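/- The binary skew-symmetric broadcast channel has input $X\in\{0,1\}$ and outputs $Y_1,Y_2\in\{0,1\}$, with $$P(Y_1=0\mid X=0)=P(Y_1=1\mid X=0)=\tfrac12,\qquad P(Y_1=1\mid X=1)=1,$$ $$P(Y_2=0\mid X=0)=1,\qquad P(Y_2=0\mid X=1)=P(Y_2=1\mid X=1)=\tfrac12;$$ the joint conditional law of $(Y_1,Y_2)$ given $X$ may be any law with these marginals. Write $I(A;B)=\sum_{a,b}P(A=a,B=b)\log_2\frac{P(A=a,B=b)}{P(A=a)P(B=b)}$ (with the terms where $P(A=a,B=b)=0$ read as $0$) for the mutual information of two finite-valued random variables. **Theorem.** Let $U,V$ be random variables with arbitrary finite alphabets, let $X$ be a $\{0,1\}$-valued random variable with an arbitrary joint law with $(U,V)$, and let $(Y_1,Y_2)$ be the output of the binary skew-symmetric broadcast channel on input $X$, such that $(U,V)-X-(Y_1,Y_2)$ is a Markov chain (that is, $(U,V)$ and $(Y_1,Y_2)$ are conditionally independent given $X$). Then $$I(U;Y_1)+I(V;Y_2)-I(U;V)\le \max\bigl(I(X;Y_1),\,I(X;Y_2)\bigr).$$ -/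

import Mathlib

open MeasureTheory

noncomputable section

namespace BSSC

/-- The probability mass `P(A = a)` of a discrete random variable `A`. -/
def pmass {Ω α : Type*} [MeasurableSpace Ω] (μ : Measure Ω) (A : Ω → α) (a : α) : ℝ :=
  μ.real {ω | A ω = a}

/-- Mutual information `I(A;B)`, in bits, of two random variables with finite alphabets:
`∑ P(a,b) log₂ (P(a,b) / (P(a) P(b)))`. Terms with `P(a,b) = 0` contribute `0`; whenever
`P(a,b) ≠ 0`, also `P(a) ≠ 0` and `P(b) ≠ 0`. -/
def mutualInfo {Ω α β : Type*} [MeasurableSpace Ω] [Fintype α] [Fintype β]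
    (μ : Measure Ω) (A : Ω → α) (B : Ω → β) : ℝ :=
  ∑ a, ∑ b, pmass μ (fun ω => (A ω, B ω)) (a, b) *
    Real.logb 2 (pmass μ (fun ω => (A ω, B ω)) (a, b) / (pmass μ A a * pmass μ B b))

/-- `A - B - C` is a Markov chain: `A` and `C` are conditionally independent given `B`, that is,
`P(a,b,c) P(b) = P(a,b) P(b,c)` for all values. -/
def IsMarkovChain {Ω α β γ : Type*} [MeasurableSpace Ω]
    (μ : Measure Ω) (A : Ω → α) (B : Ω → β) (C : Ω → γ) : Prop :=
  ∀ a b c, pmass μ (fun ω => (A ω, B ω, C ω)) (a, b, c) * pmass μ B b =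
    pmass μ (fun ω => (A ω, B ω)) (a, b) * pmass μ (fun ω => (B ω, C ω)) (b, c)

/-- Transition probabilities `W₁(y | x)` from the input to the first receiver:
input `0` gives a uniform bit, input `1` gives output `1`. -/
def chan1 (x y : Fin 2) : ℝ :=
  if x = 0 then 1 / 2 else if y = 1 then 1 else 0

/-- Transition probabilities `W₂(y | x)` from the input to the second receiver:
input `0` gives output `0`, input `1` gives a uniform bit. -/
def chan2 (x y : Fin 2) : ℝ :=
  if x = 0 then (if y = 0 then 1 else 0) else 1 / 2

/-- `Y` is the output of the channel with transition probabilities `W` on input `X`: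
`P(X = x, Y = y) = P(X = x) W(y | x)`. -/
def IsOutput {Ω α β : Type*} [MeasurableSpace Ω]
    (μ : Measure Ω) (W : α → β → ℝ) (X : Ω → α) (Y : Ω → β) : Prop :=
  ∀ x y, pmass μ (fun ω => (X ω, Y ω)) (x, y) = pmass μ X x * W x y

/-- `(Y₁, Y₂)` is the output of the binary skew-symmetric broadcast channel on input `X`. Only the
two marginal channels are prescribed; the dependence of `Y₁` and `Y₂` given `X` is arbitrary. -/
def IsBSSCOutput {Ω : Type*} [MeasurableSpace Ω]
    (μ : Measure Ω) (X Y₁ Y₂ : Ω → Fin 2) : Prop :=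
  IsOutput μ chan1 X Y₁ ∧ IsOutput μ chan2 X Y₂

end BSSC

end

/-! Expanding the mutual informations cancels `H(U)` and `H(V)`, so the left side is `H(Y₁) + H(Y₂)
+ H(U,V) - H(U,Y₁) - H(V,Y₂)`. The terms `H(Y₁)`, `H(Y₂)`, `I(X;Y₁)`, `I(X;Y₂)` depend only on the
law of `X`. Hence that law is fixed and `H(U,V) - H(U,Y₁) - H(V,Y₂)` (`objective`) is to be bounded
by `target`.

Two reductions, neither of which lowers the objective, make the problem finite. By
`exists_deterministic`, adjoining to `U` a random function `S` with `X = S(V)` makes `X` a function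
of `(U,V)`. By `exists_weights`, `U` needs only two values: the objective is convex in the weights
of the values of `U`, and fixing the law of `X` imposes two linear constraints. The same holds for
`V` by symmetry.

For binary `U`, `V` there are sixteen functions `X = f(U,V)`, which symmetry reduces to four. A
constant `X` amounts to `I(U;V) ≥ 0`, and `X = U` to data processing. For AND (`binBound_and`), the
log sum inequality leaves a one-variable function that decreases and then increases, so its maximum
is at an endpoint; the endpoints give the two terms of the maximum. For XOR (`binBound_xor`), the
objective has no interior local maximum because some direction has positive second derivative; its
maximiser over a compact rectangle therefore has an empty cell, which is an AND case.

Masses are left unnormalised, since entropy is then homogeneous up to terms that cancel. -/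

/-! ### Log sum inequality for unnormalised binary entropies. -/

open Real in
lemma negMulLog_le_of_le {s n S N : ℝ} (hs : 0 ≤ s) (hn : s ≤ n) (hS : s ≤ S) (hN : S ≤ N) :
    negMulLog s ≤ n * S / N - s - s * (log n + log S - log N) := by
  rcases hs.eq_or_lt with rfl | hs
  · have := hS.trans hN
    simp only [negMulLog_zero, sub_zero, zero_mul]; positivity
  · have hn' : 0 < n := by linarith
    have hS' : 0 < S := by linarith
    have hN' : 0 < N := by linarith
    -- `log x ≤ x - 1` at `x = nS/(Ns)`, then multiplied by `s`.
    have h := log_le_sub_one_of_pos (show 0 < n * S / N / s by positivity)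
    rw [log_div (by positivity) hs.ne', log_div (by positivity) hN'.ne',
      log_mul hn'.ne' hS'.ne'] at h
    have h2 := mul_le_mul_of_nonneg_left h hs.le
    have h3 : s * (n * S / N / s - 1) = n * S / N - s := by field_simp
    rw [negMulLog]
    linarith

lemma negMulLog_half (x : ℝ) :
    Real.negMulLog (x / 2) = Real.negMulLog x / 2 + x / 2 * Real.log 2 := by
  rcases eq_or_ne x 0 with rfl | hx
  · simp
  · rw [Real.negMulLog, Real.negMulLog, Real.log_div hx (by norm_num)]; ring

/-- The unnormalised binary entropy of the masses `s` and `t`. -/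
noncomputable def splitEntropy (s t : ℝ) : ℝ :=
  Real.negMulLog s + Real.negMulLog t - Real.negMulLog (s + t)

lemma splitEntropy_half (s t : ℝ) : splitEntropy (s / 2) (t / 2) = splitEntropy s t / 2 := by
  rw [splitEntropy, splitEntropy, ← add_div, negMulLog_half, negMulLog_half, negMulLog_half]
  ring

/-- Gibbs' inequality: coding the split `s : t` with the proportions `S : T` costs at least its
entropy. The linear terms of the two estimates cancel. -/
lemma splitEntropy_le {s t S T : ℝ} (hs : 0 ≤ s) (ht : 0 ≤ t) (hS : s ≤ S) (hT : t ≤ T) :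
    splitEntropy s t ≤ (s + t) * Real.log (S + T) - s * Real.log S - t * Real.log T := by
  rcases (show 0 ≤ S + T by linarith).eq_or_lt with h | h
  · obtain rfl : s = 0 := by linarith
    obtain rfl : t = 0 := by linarith
    simp [splitEntropy]
  · have h1 := negMulLog_le_of_le hs (show s ≤ s + t by linarith) hS (show S ≤ S + T by linarith)
    have h2 := negMulLog_le_of_le ht (show t ≤ s + t by linarith) hT (show T ≤ S + T by linarith)
    have h3 : (s + t) * S / (S + T) + (s + t) * T / (S + T) = s + t := by field_simp
    rw [splitEntropy, Real.negMulLog.eq_1 (s + t)]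
    linarith

/-- Log sum inequality. -/
lemma splitEntropy_add_le {s t s' t' : ℝ} (hs : 0 ≤ s) (ht : 0 ≤ t) (hs' : 0 ≤ s') (ht' : 0 ≤ t') :
    splitEntropy s t + splitEntropy s' t' ≤ splitEntropy (s + s') (t + t') := by
  have h1 := splitEntropy_le hs ht (show s ≤ s + s' by linarith) (show t ≤ t + t' by linarith)
  have h2 := splitEntropy_le hs' ht' (show s' ≤ s + s' by linarith) (show t' ≤ t + t' by linarith)
  rw [splitEntropy.eq_1 (s + s')]
  simp only [Real.negMulLog]
  linarith

lemma sum_splitEntropy_le {ι : Type*} (A : Finset ι) {s t : ι → ℝ} (hs : ∀ i, 0 ≤ s i)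
    (ht : ∀ i, 0 ≤ t i) :
    ∑ i ∈ A, splitEntropy (s i) (t i) ≤ splitEntropy (∑ i ∈ A, s i) (∑ i ∈ A, t i) := by
  classical
  induction A using Finset.induction_on with
  | empty => simp [splitEntropy]
  | insert i A hi ih =>
    rw [Finset.sum_insert hi, Finset.sum_insert hi, Finset.sum_insert hi]
    have := splitEntropy_add_le (hs i) (ht i) (Finset.sum_nonneg fun j (_ : j ∈ A) => hs j)
      (Finset.sum_nonneg fun j (_ : j ∈ A) => ht j)
    linarith

/-! ### The binary objective and its symmetries. -/

/-- The unnormalised output entropy of the first receiver when the input masses of `0` and `1` are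
`s` and `t`. The second receiver has output entropy `outEntropy t s`. -/
noncomputable def outEntropy (s t : ℝ) : ℝ :=
  Real.negMulLog (s / 2) + Real.negMulLog (t + s / 2)

lemma outEntropy_zero_left (t : ℝ) : outEntropy 0 t = Real.negMulLog t := by simp [outEntropy]

lemma outEntropy_zero_right (s : ℝ) :
    outEntropy s 0 = Real.negMulLog s + s * Real.log 2 := by
  rw [outEntropy, zero_add, negMulLog_half]; ring

lemma outEntropy_eq (s t : ℝ) :
    outEntropy s t = splitEntropy (s / 2) (t + s / 2) + Real.negMulLog (s + t) := by
  rw [outEntropy, splitEntropy, show s / 2 + (t + s / 2) = s + t by ring]; ring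

/-- `max (I(X;Y₁), I(X;Y₂)) - H(Y₁) - H(Y₂)`, unnormalised and in nats. -/
noncomputable def target (p q : ℝ) : ℝ :=
  max (-p * Real.log 2 - outEntropy q p) (-q * Real.log 2 - outEntropy p q)

lemma target_comm (p q : ℝ) : target p q = target q p := max_comm _ _

/-- `H(U,V) - H(U,Y₁) - H(V,Y₂)`, unnormalised and in nats, for two-valued `U` and `V`. Each cell of
the joint law carries a mass with `X = 0` and a mass with `X = 1`. -/
noncomputable def binObjective (a₀ a₁ b₀ b₁ c₀ c₁ d₀ d₁ : ℝ) : ℝ :=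
  Real.negMulLog (a₀ + a₁) + Real.negMulLog (b₀ + b₁) + Real.negMulLog (c₀ + c₁)
    + Real.negMulLog (d₀ + d₁) - outEntropy (a₀ + b₀) (a₁ + b₁) - outEntropy (c₀ + d₀) (c₁ + d₁)
    - outEntropy (a₁ + c₁) (a₀ + c₀) - outEntropy (b₁ + d₁) (b₀ + d₀)

/-- The claimed bound for two-valued `U` and `V`. -/
def BinBound (a₀ a₁ b₀ b₁ c₀ c₁ d₀ d₁ : ℝ) : Prop :=
  binObjective a₀ a₁ b₀ b₁ c₀ c₁ d₀ d₁ ≤ target (a₀ + b₀ + c₀ + d₀) (a₁ + b₁ + c₁ + d₁)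

lemma BinBound.swap_rows {a₀ a₁ b₀ b₁ c₀ c₁ d₀ d₁ : ℝ} (h : BinBound c₀ c₁ d₀ d₁ a₀ a₁ b₀ b₁) :
    BinBound a₀ a₁ b₀ b₁ c₀ c₁ d₀ d₁ := by
  unfold BinBound binObjective at *
  rw [add_comm a₁ c₁, add_comm a₀ c₀, add_comm b₁ d₁, add_comm b₀ d₀,
    show a₀ + b₀ + (c₀) + d₀ = c₀ + d₀ + a₀ + b₀ by ring,
    show a₁ + b₁ + (c₁) + d₁ = c₁ + d₁ + a₁ + b₁ by ring]
  linarith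

lemma BinBound.swap_cols {a₀ a₁ b₀ b₁ c₀ c₁ d₀ d₁ : ℝ} (h : BinBound b₀ b₁ a₀ a₁ d₀ d₁ c₀ c₁) :
    BinBound a₀ a₁ b₀ b₁ c₀ c₁ d₀ d₁ := by
  unfold BinBound binObjective at *
  rw [show b₀ + a₀ + d₀ + c₀ = a₀ + b₀ + c₀ + d₀ by ring,
    show b₁ + a₁ + d₁ + c₁ = a₁ + b₁ + c₁ + d₁ by ring, add_comm b₀ a₀, add_comm b₁ a₁,
    add_comm d₀ c₀, add_comm d₁ c₁] at h
  linarith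

/-- The channel is skew-symmetric: exchanging `U` with `V` and input `0` with input `1` exchanges
the two receivers. -/
lemma BinBound.transpose {a₀ a₁ b₀ b₁ c₀ c₁ d₀ d₁ : ℝ} (h : BinBound a₁ a₀ c₁ c₀ b₁ b₀ d₁ d₀) :
    BinBound a₀ a₁ b₀ b₁ c₀ c₁ d₀ d₁ := by
  unfold BinBound binObjective at *
  rw [target_comm, show a₁ + c₁ + b₁ + d₁ = a₁ + b₁ + c₁ + d₁ by ring,
    show a₀ + c₀ + b₀ + d₀ = a₀ + b₀ + c₀ + d₀ by ring, add_comm a₁ a₀, add_comm b₁ b₀,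
    add_comm c₁ c₀, add_comm d₁ d₀] at h
  linarith

/-! ### Binary `U`, `V`: constant `X`, `X = U`, and AND. -/

lemma binBound_const {a b c d : ℝ} (ha : 0 ≤ a) (hb : 0 ≤ b) (hc : 0 ≤ c) (hd : 0 ≤ d) :
    BinBound a 0 b 0 c 0 d 0 := by
  refine le_max_of_le_left ?_
  have h := splitEntropy_add_le ha hb hc hd
  simp only [splitEntropy] at h
  simp only [binObjective, add_zero, outEntropy_zero_left, outEntropy_zero_right]
  rw [show a + c + (b + d) = a + b + c + d by ring] at h
  linarith

/-- Here `X = U`, and the bound is the data processing inequality `I(V;Y₂) ≤ I(V;X)`. The halves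
come from input `1` reaching `Y₂ = 0` with probability `1/2`. -/
lemma binBound_fst {a b c d : ℝ} (ha : 0 ≤ a) (hb : 0 ≤ b) (hc : 0 ≤ c) (hd : 0 ≤ d) :
    BinBound a 0 b 0 0 c 0 d := by
  refine le_max_of_le_left ?_
  have h := splitEntropy_add_le ha hb (show 0 ≤ c / 2 by linarith) (show 0 ≤ d / 2 by linarith)
  rw [splitEntropy_half] at h
  simp only [splitEntropy] at h
  simp only [binObjective, add_zero, zero_add, outEntropy_zero_left, outEntropy_zero_right]
  simp only [outEntropy]
  rw [show a + c / 2 + (b + d / 2) = a + b + (c + d) / 2 by ring] at h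
  rw [negMulLog_half c, negMulLog_half d, negMulLog_half (c + d)]
  linarith

/-- The derivative in `b` has the sign of `b(2a + b) - (b + a/2)² = a(b - a/4)`, so the function
decreases up to `a/4` and increases afterwards; the right side is the maximum of its values at `0`
and `p`. -/
lemma sub_negMulLog_le_max {a p b : ℝ} (ha : 0 ≤ a) (hb : 0 ≤ b) (hbp : b ≤ p) :
    b * Real.log 2 - Real.negMulLog (b / 2) - Real.negMulLog (a + b / 2) + Real.negMulLog (b + a / 2)
      ≤ max (Real.negMulLog (a / 2) - Real.negMulLog a)
        (p * Real.log 2 - Real.negMulLog (p / 2) - Real.negMulLog (a + p / 2)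
          + Real.negMulLog (p + a / 2)) := by
  set g : ℝ → ℝ := fun b => b * Real.log 2 - Real.negMulLog (b / 2) - Real.negMulLog (a + b / 2)
    + Real.negMulLog (b + a / 2) with hg
  rcases ha.eq_or_lt with rfl | ha
  -- For `a = 0` the function vanishes identically.
  · refine le_max_of_le_left ?_
    simp only [negMulLog_half, zero_div, zero_add, add_zero, Real.negMulLog_zero]
    linarith
  have hcont : Continuous g := by
    have := Real.continuous_negMulLog
    fun_prop
  have hderiv : ∀ x : ℝ, 0 < x → HasDerivAt g (Real.log 2 - (-Real.log (x / 2) - 1) * (1 / 2)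
      - (-Real.log (a + x / 2) - 1) * (1 / 2) + (-Real.log (x + a / 2) - 1) * 1) x := by
    intro x hx
    have h1 : HasDerivAt (fun x : ℝ => x / 2) (1 / 2) x := (hasDerivAt_id x).div_const 2
    have h2 : HasDerivAt (fun x : ℝ => a + x / 2) (1 / 2) x := h1.const_add a
    have h3 : HasDerivAt (fun x : ℝ => x + a / 2) 1 x := (hasDerivAt_id x).add_const _
    have h0 : HasDerivAt (fun x : ℝ => x * Real.log 2) (1 * Real.log 2) x :=
      (hasDerivAt_id x).mul_const _
    have e1 := (Real.hasDerivAt_negMulLog (show x / 2 ≠ 0 by positivity)).comp x h1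
    have e2 := (Real.hasDerivAt_negMulLog (show a + x / 2 ≠ 0 by positivity)).comp x h2
    have e3 := (Real.hasDerivAt_negMulLog (show x + a / 2 ≠ 0 by positivity)).comp x h3
    rw [one_mul] at h0
    exact ((h0.sub e1).sub e2).add e3
  have key : ∀ x : ℝ, 0 < x → deriv g x
      = (Real.log (x * (2 * a + x)) - Real.log ((x + a / 2) ^ 2)) / 2 := by
    intro x hx
    rw [(hderiv x hx).deriv, Real.log_pow, show x * (2 * a + x) = 2 ^ 2 * (x / 2) * (a + x / 2) by ring,
      Real.log_mul (by positivity) (by positivity), Real.log_mul (by positivity) (by positivity),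
      Real.log_pow]
    push_cast
    ring
  have g0 : g 0 = Real.negMulLog (a / 2) - Real.negMulLog a := by simp [hg]; ring
  rcases le_total b (a / 4) with h | h
  · refine le_max_of_le_left ?_
    rw [← g0]
    have : AntitoneOn g (Set.Icc 0 (a / 4)) := by
      refine antitoneOn_of_deriv_nonpos (convex_Icc _ _) hcont.continuousOn ?_ ?_
      · rw [interior_Icc]
        exact fun x hx => (hderiv x hx.1).differentiableAt.differentiableWithinAt
      · rw [interior_Icc]
        rintro x ⟨hx, hx'⟩
        rw [key x hx]
        have := Real.log_le_log (show 0 < x * (2 * a + x) by positivity)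
          (show x * (2 * a + x) ≤ (x + a / 2) ^ 2 by nlinarith)
        linarith
    exact this ⟨le_rfl, by positivity⟩ ⟨hb, h⟩ hb
  · refine le_max_of_le_right ?_
    have : MonotoneOn g (Set.Icc (a / 4) p) := by
      refine monotoneOn_of_deriv_nonneg (convex_Icc _ _) hcont.continuousOn ?_ ?_
      · rw [interior_Icc]
        exact fun x hx =>
          (hderiv x (by linarith [hx.1])).differentiableAt.differentiableWithinAt
      · rw [interior_Icc]
        rintro x ⟨hx, hx'⟩
        have hx0 : 0 < x := by linarith
        rw [key x hx0]
        have := Real.log_le_log (show 0 < (x + a / 2) ^ 2 by positivity)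
          (show (x + a / 2) ^ 2 ≤ x * (2 * a + x) by nlinarith)
        linarith
    exact this ⟨h, hbp⟩ ⟨h.trans hbp, le_rfl⟩ hbp

lemma binBound_and {a b c d : ℝ} (ha : 0 ≤ a) (hb : 0 ≤ b) (hc : 0 ≤ c) (hd : 0 ≤ d) :
    BinBound 0 a b 0 c 0 d 0 := by
  -- Log sum eliminates `c` and `d` except through `p = b + c + d`. The remaining endpoints are `b =
  -- 0`, where `X` is determined by `U`, and `b = p`, where it is determined by `V`.
  have h1 := splitEntropy_add_le hc (show 0 ≤ a / 2 by linarith) hd hb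
  have h2 := sub_negMulLog_le_max ha hb (show b ≤ b + c + d by linarith)
  have e1 := negMulLog_half a
  have e2 := negMulLog_half b
  have e3 := negMulLog_half (b + c + d)
  simp only [splitEntropy] at h1
  rw [show c + d + (a / 2 + b) = b + c + d + a / 2 by ring, add_comm (a / 2) b, add_comm d b] at h1
  simp only [BinBound, binObjective, target, add_zero, zero_add, outEntropy_zero_left,
    outEntropy_zero_right]
  simp only [outEntropy]
  rcases le_max_iff.1 h2 with h | h
  · refine le_max_of_le_left ?_
    linarith
  · refine le_max_of_le_right ?_
    linarith

/-! ### Binary `U`, `V`: XOR. -/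

lemma not_isLocalMax_of_hasDerivAt {f f' : ℝ → ℝ} {D : ℝ}
    (hf : ∀ᶠ t in nhds 0, HasDerivAt f (f' t) t) (hf' : HasDerivAt f' D 0) (hD : 0 < D) :
    ¬ IsLocalMax f 0 := by
  intro hmax
  have hd : deriv f =ᶠ[nhds 0] f' := hf.mono fun t ht => ht.deriv
  have hdd : deriv (deriv f) 0 = D := hd.deriv_eq.trans hf'.deriv
  -- A local maximum would also be a local minimum, so `f` would be locally constant and `D = 0`.
  have hmin := isLocalMin_of_deriv_deriv_pos (hdd ▸ hD) hmax.deriv_eq_zero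
    hf.self_of_nhds.continuousAt
  have hconst : f =ᶠ[nhds 0] fun _ => f 0 := by
    filter_upwards [hmax, hmin] with t h1 h2 using le_antisymm h1 h2
  have : deriv (deriv f) 0 = 0 := by
    rw [(hconst.deriv).deriv_eq]
    simp
  linarith

lemma hasDerivAt_negMulLog_line {p q : ℝ} (hp : 0 < p) :
    (∀ᶠ t in nhds (0 : ℝ), HasDerivAt (fun t => Real.negMulLog (p + t * q))
      ((-Real.log (p + t * q) - 1) * q) t) ∧
    HasDerivAt (fun t => (-Real.log (p + t * q) - 1) * q) (-(q ^ 2 / p)) 0 := by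
  have hl : ∀ t : ℝ, HasDerivAt (fun t : ℝ => p + t * q) q t := fun t => by
    simpa using ((hasDerivAt_id t).mul_const q).const_add p
  constructor
  · have : ∀ᶠ t in nhds (0 : ℝ), 0 < p + t * q :=
      (hl 0).continuousAt.eventually (lt_mem_nhds (by simpa using hp))
    filter_upwards [this] with t ht
    exact (Real.hasDerivAt_negMulLog ht.ne').comp t (hl t)
  · have := ((((hl 0).log (by simpa using hp.ne')).neg).sub_const 1).mul_const q
    convert! this using 1
    simp
    ring

/-- The nonlinear part of the objective when `X` is the sum of `U` and `V` modulo two. -/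
noncomputable def xorObjective (a b c d : ℝ) : ℝ :=
  (Real.negMulLog a + Real.negMulLog b + Real.negMulLog c + Real.negMulLog d) / 2
    - Real.negMulLog (b + a / 2) - Real.negMulLog (c + d / 2) - Real.negMulLog (a + c / 2)
    - Real.negMulLog (d + b / 2)

/-- The mixed terms run round the cycle `b, a, c, d`, so a quarter turn of the square of cells
permutes them. -/
lemma xorObjective_rotate (a b c d : ℝ) : xorObjective b d a c = xorObjective a b c d := by
  unfold xorObjective; ring

lemma binObjective_xor (a b c d : ℝ) :
    binObjective a 0 0 b 0 c d 0 = xorObjective a b c d - (a + b + c + d) / 2 * Real.log 2 := by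
  simp only [binObjective, xorObjective, outEntropy, add_zero, zero_add, negMulLog_half]
  ring

/-- The expression is twice the second derivative of `xorObjective` along `(d, c, -c, -d)`. -/
lemma xor_second_derivative_pos {a b c d : ℝ} (hc : 0 < c) (hd : 0 < d)
    (had : d ≤ a) (hbc : c ≤ b) :
    0 < c - d ^ 2 / a - c ^ 2 / b + (d + 2 * c) ^ 2 / (a + 2 * b)
      + (2 * d - c) ^ 2 * (1 / (2 * a + c) + 1 / (2 * d + b)) := by
  have ha : 0 < a := by linarith
  have hb : 0 < b := by linarith
  have hlast : 0 ≤ (2 * d - c) ^ 2 * (1 / (2 * d + b)) := by positivity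
  have hmid : 0 ≤ (2 * d - c) ^ 2 * (1 / (2 * a + c)) := by positivity
  -- The Cauchy–Schwarz inequality for `d²/a + (2c)²/(2b)` with its exact defect. Left to prove is
  -- that `c + c²/b` plus the last terms exceeds the defect.
  have e : (d + 2 * c) ^ 2 / (a + 2 * b)
      = d ^ 2 / a + 2 * c ^ 2 / b - 2 * (b * d - a * c) ^ 2 / (a * b * (a + 2 * b)) := by
    field_simp; ring
  have hsq : 0 < c ^ 2 / b := by positivity
  rcases le_total (b * d) (a * c) with h | h
  · have h1 : 2 * (b * d - a * c) ^ 2 / (a * b * (a + 2 * b)) ≤ 2 * c ^ 2 / b * (a / (a + 2 * b)) := by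
      rw [div_mul_div_comm, div_le_div_iff₀ (by positivity) (by positivity)]
      have : (b * d - a * c) ^ 2 ≤ (a * c) ^ 2 := by
        apply sq_le_sq'
        · have := mul_pos hb hd
          linarith
        · have := mul_pos ha hc
          linarith
      have h3 : 0 ≤ b * (a + 2 * b) := by positivity
      nlinarith [mul_le_mul_of_nonneg_right this h3]
    have h2 : a / (a + 2 * b) < 1 := by rw [div_lt_one (by positivity)]; linarith
    have h3 : c ^ 2 / b ≤ c := by rw [div_le_iff₀ hb]; nlinarith
    have h4 : 2 * c ^ 2 / b * (a / (a + 2 * b)) < 2 * c ^ 2 / b * 1 := by gcongr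
    have h5 : 2 * c ^ 2 / b = 2 * (c ^ 2 / b) := by ring
    linarith
  · have h1 : 2 * (b * d - a * c) ^ 2 / (a * b * (a + 2 * b)) ≤ d ^ 2 / a := by
      rw [div_le_div_iff₀ (by positivity) (by positivity)]
      have : (b * d - a * c) ^ 2 ≤ (b * d) ^ 2 := by
        apply sq_le_sq'
        · have := mul_pos hb hd
          linarith
        · have := mul_pos ha hc
          linarith
      have h3 : 0 ≤ d ^ 2 * a ^ 2 * b := by positivity
      nlinarith [mul_le_mul_of_nonneg_right this ha.le]
    have h2 : 0 < c - d ^ 2 / a + (2 * d - c) ^ 2 * (1 / (2 * a + c)) := by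
      have : c - d ^ 2 / a + (2 * d - c) ^ 2 * (1 / (2 * a + c))
          = (a * (2 * a * c - 4 * d * c + 2 * c ^ 2 + 2 * d ^ 2) - d ^ 2 * c)
            / (a * (2 * a + c)) := by
        field_simp; ring
      rw [this]
      apply div_pos _ (by positivity)
      -- The numerator is smallest at `a = d`, where it equals `d` times this positive definite
      -- form.
      have h3 : 0 < 2 * d ^ 2 - 3 * d * c + 2 * c ^ 2 := by
        nlinarith [sq_nonneg (d - c), mul_pos hc hd, sq_nonneg (4 * d - 3 * c), sq_pos_of_pos hc]
      have h4 : 2 * d * c - 4 * d * c + 2 * c ^ 2 + 2 * d ^ 2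
          ≤ 2 * a * c - 4 * d * c + 2 * c ^ 2 + 2 * d ^ 2 := by
        have := mul_le_mul_of_nonneg_right had hc.le
        linarith
      have h5 : d * (2 * d * c - 4 * d * c + 2 * c ^ 2 + 2 * d ^ 2)
          ≤ a * (2 * a * c - 4 * d * c + 2 * c ^ 2 + 2 * d ^ 2) := by
        apply mul_le_mul had h4 _ ha.le
        nlinarith [sq_nonneg (d - c), mul_pos hc hd]
      nlinarith [mul_pos hd h3]
    rw [e, mul_add ((2 * d - c) ^ 2), mul_div_assoc 2 (c ^ 2) b]
    linarith

/-- The direction shrinks the row `c, d` proportionally and moves its mass to the cells of the other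
row with the same `X`, which keeps the law of `X`. -/
lemma exists_direction_of_le {a b c d : ℝ} (hc : 0 < c) (hd : 0 < d) (had : d ≤ a) (hbc : c ≤ b) :
    ¬ IsLocalMax (fun t : ℝ => xorObjective (a + t * d) (b + t * c) (c + t * (-c)) (d + t * (-d))) 0 := by
  have ha : 0 < a := by linarith
  have hb : 0 < b := by linarith
  obtain ⟨a1, a2⟩ := hasDerivAt_negMulLog_line (q := d) ha
  obtain ⟨b1, b2⟩ := hasDerivAt_negMulLog_line (q := c) hb
  obtain ⟨c1, c2⟩ := hasDerivAt_negMulLog_line (q := -c) hc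
  obtain ⟨d1, d2⟩ := hasDerivAt_negMulLog_line (q := -d) hd
  obtain ⟨e1, e2⟩ := hasDerivAt_negMulLog_line (p := b + a / 2) (q := c + d / 2) (by positivity)
  obtain ⟨f1, f2⟩ := hasDerivAt_negMulLog_line (p := c + d / 2) (q := -c - d / 2) (by positivity)
  obtain ⟨g1, g2⟩ := hasDerivAt_negMulLog_line (p := a + c / 2) (q := d - c / 2) (by positivity)
  obtain ⟨h1, h2⟩ := hasDerivAt_negMulLog_line (p := d + b / 2) (q := -d + c / 2) (by positivity)
  have key := not_isLocalMax_of_hasDerivAt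
    (by filter_upwards [a1, b1, c1, d1, e1, f1, g1, h1] with t a1 b1 c1 d1 e1 f1 g1 h1
        exact ((((((((a1.add b1).add c1).add d1).div_const 2).sub e1).sub f1).sub g1).sub h1))
    ((((((((a2.add b2).add c2).add d2).div_const 2).sub e2).sub f2).sub g2).sub h2) (by
      have := xor_second_derivative_pos hc hd had hbc
      have e : c - d ^ 2 / a - c ^ 2 / b + (d + 2 * c) ^ 2 / (a + 2 * b)
          + (2 * d - c) ^ 2 * (1 / (2 * a + c) + 1 / (2 * d + b)) =
        2 * ((-(d ^ 2 / a) + -(c ^ 2 / b) + -((-c) ^ 2 / c) + -((-d) ^ 2 / d)) / 2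
          - -((c + d / 2) ^ 2 / (b + a / 2)) - -((-c - d / 2) ^ 2 / (c + d / 2))
          - -((d - c / 2) ^ 2 / (a + c / 2)) - -((-d + c / 2) ^ 2 / (d + b / 2))) := by
        rw [show b + a / 2 = (a + 2 * b) / 2 by ring, show a + c / 2 = (2 * a + c) / 2 by ring,
          show d + b / 2 = (2 * d + b) / 2 by ring,
          show (-c - d / 2) ^ 2 / (c + d / 2) = c + d / 2 by field_simp; ring,
          show (-c) ^ 2 / c = c by field_simp, show (-d) ^ 2 / d = d by field_simp]
        field_simp
        ring
      linarith)
  convert key using 2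
  ext t
  simp only [xorObjective, Pi.add_apply, Pi.sub_apply]
  rw [show b + t * c + (a + t * d) / 2 = b + a / 2 + t * (c + d / 2) by ring,
    show c + t * -c + (d + t * -d) / 2 = c + d / 2 + t * (-c - d / 2) by ring,
    show a + t * d + (c + t * -c) / 2 = a + c / 2 + t * (d - c / 2) by ring,
    show d + t * -d + (b + t * c) / 2 = d + b / 2 + t * (-d + c / 2) by ring]

/-- `xorObjective` has no local maximum in the interior for fixed law of `X`. -/
lemma exists_direction {a b c d : ℝ} (ha : 0 < a) (hb : 0 < b) (hc : 0 < c) (hd : 0 < d) :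
    ∃ x y : ℝ, ¬ IsLocalMax
      (fun t : ℝ => xorObjective (a + t * x) (b + t * y) (c + t * (-y)) (d + t * (-x))) 0 := by
  -- In each pair of cells with equal `X`, mass moves from the smaller to the larger; rotation turns
  -- each case into the one already treated.
  rcases le_total d a with h1 | h1 <;> rcases le_total c b with h2 | h2
  · exact ⟨d, c, exists_direction_of_le hc hd h1 h2⟩
  · refine ⟨d, -b, ?_⟩
    have := exists_direction_of_le hd hb h2 h1
    simp only [neg_neg]
    convert this using 3
    rw [← xorObjective_rotate, ← xorObjective_rotate, ← xorObjective_rotate]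
  · refine ⟨-a, c, ?_⟩
    have := exists_direction_of_le ha hc h2 h1
    simp only [neg_neg]
    convert this using 3
    rw [← xorObjective_rotate]
  · refine ⟨-a, -b, ?_⟩
    have := exists_direction_of_le hb ha h1 h2
    simp only [neg_neg]
    convert this using 3
    rw [← xorObjective_rotate, ← xorObjective_rotate]

lemma binBound_xor {a b c d : ℝ} (ha : 0 ≤ a) (hb : 0 ≤ b) (hc : 0 ≤ c) (hd : 0 ≤ d) :
    BinBound a 0 0 b 0 c d 0 := by
  set p := a + d with hp
  set q := b + c with hq
  set G : ℝ × ℝ → ℝ := fun z => xorObjective z.1 z.2 (q - z.2) (p - z.1) with hG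
  have hcont : Continuous G := by
    have := Real.continuous_negMulLog
    unfold G xorObjective
    fun_prop
  obtain ⟨⟨x, y⟩, ⟨hx, hy⟩, hmax⟩ := ((isCompact_Icc (a := (0 : ℝ)) (b := p)).prod
    (isCompact_Icc (a := (0 : ℝ)) (b := q))).exists_isMaxOn
      ⟨(a, b), ⟨ha, by simp [p, hd]⟩, ⟨hb, by simp [q, hc]⟩⟩ hcont.continuousOn
  simp only [Set.mem_Icc] at hx hy
  have hle : G (a, b) ≤ G (x, y) := hmax ⟨⟨ha, by simp [p, hd]⟩, ⟨hb, by simp [q, hc]⟩⟩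
  -- `target` depends only on `p` and `q`, so the maximiser is the worst case.
  suffices h : BinBound x 0 0 y 0 (q - y) (p - x) 0 by
    unfold BinBound at *
    rw [binObjective_xor] at *
    have e : G (a, b) = xorObjective a b c d := by simp [hG, p, q]
    have e' : G (x, y) = xorObjective x y (q - y) (p - x) := rfl
    rw [show x + y + (q - y) + (p - x) = a + b + c + d by simp [p, q]; ring,
      show x + 0 + 0 + (p - x) = a + 0 + 0 + d by simp [p],
      show 0 + y + (q - y) + 0 = 0 + b + c + 0 by simp [q]] at h
    linarith
  have hx' : 0 ≤ p - x := by linarith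
  have hy' : 0 ≤ q - y := by linarith
  rcases hx.1.eq_or_lt with h0 | hx0
  · rw [← h0] at hx' ⊢
    exact (binBound_and hx' hy.1 hy' le_rfl).swap_rows.swap_cols.transpose
  rcases hx'.eq_or_lt with h0 | hx1
  · rw [← h0]
    exact (binBound_and hx.1 hy' hy.1 le_rfl).transpose
  rcases hy.1.eq_or_lt with h0 | hy0
  · rw [← h0] at hy' ⊢
    exact (binBound_and hy' hx' hx.1 le_rfl).swap_rows
  rcases hy'.eq_or_lt with h0 | hy1
  · rw [← h0]
    exact (binBound_and hy.1 hx.1 hx' le_rfl).swap_cols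
  exfalso
  obtain ⟨u, v, huv⟩ := exists_direction hx0 hy0 hy1 hx1
  apply huv
  have hline : Filter.Tendsto (fun t : ℝ => (x + t * u, y + t * v)) (nhds 0) (nhds (x, y)) := by
    have : Continuous (fun t : ℝ => (x + t * u, y + t * v)) := by fun_prop
    simpa using this.tendsto 0
  have hnhds : Set.Icc 0 p ×ˢ Set.Icc 0 q ∈ nhds (x, y) :=
    prod_mem_nhds (Icc_mem_nhds hx0 (by linarith)) (Icc_mem_nhds hy0 (by linarith))
  filter_upwards [hline hnhds] with t ht
  have := hmax ht
  simp only [hG, Set.mem_ofPred_eq] at this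
  simp only [zero_mul, add_zero]
  convert this using 2 <;> ring

/-! ### All sixteen functions of two bits. -/

/-- The bound for two-valued `U` and `V` when `X` is a function of `(U, V)`. -/
lemma binBound_of_deterministic {a₀ a₁ b₀ b₁ c₀ c₁ d₀ d₁ : ℝ}
    (ha₀ : 0 ≤ a₀) (ha₁ : 0 ≤ a₁) (hb₀ : 0 ≤ b₀) (hb₁ : 0 ≤ b₁)
    (hc₀ : 0 ≤ c₀) (hc₁ : 0 ≤ c₁) (hd₀ : 0 ≤ d₀) (hd₁ : 0 ≤ d₁)
    (ha : a₀ = 0 ∨ a₁ = 0) (hb : b₀ = 0 ∨ b₁ = 0) (hc : c₀ = 0 ∨ c₁ = 0) (hd : d₀ = 0 ∨ d₁ = 0) :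
    BinBound a₀ a₁ b₀ b₁ c₀ c₁ d₀ d₁ := by
  rcases ha with rfl | rfl <;> rcases hb with rfl | rfl <;> rcases hc with rfl | rfl <;>
    rcases hd with rfl | rfl
  · exact (binBound_const ha₁ hc₁ hb₁ hd₁).transpose
  · exact (binBound_and hd₀ hb₁ hc₁ ha₁).swap_cols.swap_rows.transpose
  · exact (binBound_and hc₀ ha₁ hd₁ hb₁).swap_cols.transpose
  · exact (binBound_fst hc₀ hd₀ ha₁ hb₁).swap_rows
  · exact (binBound_and hb₀ hd₁ ha₁ hc₁).swap_rows.transpose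
  · exact (binBound_fst ha₁ hc₁ hb₀ hd₀).transpose
  · exact (binBound_xor hb₀ ha₁ hd₁ hc₀).swap_cols
  · exact binBound_and ha₁ hb₀ hc₀ hd₀
  · exact (binBound_and ha₀ hc₁ hb₁ hd₁).transpose
  · exact binBound_xor ha₀ hb₁ hc₁ hd₀
  · exact (binBound_fst hb₁ hd₁ ha₀ hc₀).swap_rows.transpose
  · exact (binBound_and hb₁ ha₀ hd₀ hc₀).swap_cols
  · exact binBound_fst ha₀ hb₀ hc₁ hd₁
  · exact (binBound_and hc₁ hd₀ ha₀ hb₀).swap_rows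
  · exact (binBound_and hd₁ hc₀ hb₀ ha₀).swap_cols.swap_rows
  · exact binBound_const ha₀ hb₀ hc₀ hd₀

/-! ### Reduction to two-valued `U` and `V`. -/

section General

variable {α β : Type*} [Fintype α] [Fintype β]

/-- `H(U,V) - H(U,Y₁) - H(V,Y₂)`, unnormalised and in nats, where `m₀ u v` and `m₁ u v` are the
masses of `(U, V, X) = (u, v, 0)` and `(U, V, X) = (u, v, 1)`. -/
noncomputable def objective (m₀ m₁ : α → β → ℝ) : ℝ :=
  ∑ u, ∑ v, Real.negMulLog (m₀ u v + m₁ u v) - ∑ u, outEntropy (∑ v, m₀ u v) (∑ v, m₁ u v)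
    - ∑ v, outEntropy (∑ u, m₁ u v) (∑ u, m₀ u v)

lemma objective_transpose (m₀ m₁ : α → β → ℝ) :
    objective (fun v u => m₁ u v) (fun v u => m₀ u v) = objective m₀ m₁ := by
  unfold objective
  rw [Finset.sum_comm]
  simp only [add_comm (m₁ _ _)]
  ring

lemma objective_option (m₀ m₁ : α → β → ℝ) :
    objective (fun u (v : Option β) => v.elim 0 (m₀ u)) (fun u v => v.elim 0 (m₁ u))
      = objective m₀ m₁ := by
  simp [objective, Fintype.sum_option, outEntropy]

lemma outEntropy_le_outEntropy_add {s t s' t' a b : ℝ} (hs : 0 ≤ s) (ht : 0 ≤ t) (hs' : 0 ≤ s')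
    (ht' : 0 ≤ t') (ha : 0 ≤ a) (hb : 0 ≤ b) (hab : a + b = 1) :
    a * outEntropy s t + b * outEntropy s' t' ≤ outEntropy (a * s + b * s') (a * t + b * t') := by
  have h1 := Real.concaveOn_negMulLog.2 (show s / 2 ∈ Set.Ici 0 by simp; positivity)
    (show s' / 2 ∈ Set.Ici 0 by simp; positivity) ha hb hab
  have h2 := Real.concaveOn_negMulLog.2 (show t + s / 2 ∈ Set.Ici 0 by simp; positivity)
    (show t' + s' / 2 ∈ Set.Ici 0 by simp; positivity) ha hb hab
  simp only [smul_eq_mul] at h1 h2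
  unfold outEntropy
  rw [show (a * s + b * s') / 2 = a * (s / 2) + b * (s' / 2) by ring,
    show a * t + b * t' + (a * (s / 2) + b * (s' / 2)) = a * (t + s / 2) + b * (t' + s' / 2) by ring]
  linarith

/-- By `negMulLog (w x) = x negMulLog w + w negMulLog x`; the terms in `negMulLog w` cancel because
cells and outputs have the same total mass. -/
lemma sum_negMulLog_sub_outEntropy_mul {m₀ m₁ : β → ℝ} (w : ℝ) :
    ∑ v, Real.negMulLog (w * m₀ v + w * m₁ v) - outEntropy (∑ v, w * m₀ v) (∑ v, w * m₁ v)
      = w * (∑ v, Real.negMulLog (m₀ v + m₁ v) - outEntropy (∑ v, m₀ v) (∑ v, m₁ v)) := by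
  simp only [← Finset.mul_sum, ← mul_add, outEntropy, mul_div_assoc, Real.negMulLog_mul,
    Finset.sum_add_distrib, ← Finset.sum_mul]
  ring

lemma objective_mul (m₀ m₁ : α → β → ℝ) (w : α → ℝ) :
    objective (fun u v => w u * m₀ u v) (fun u v => w u * m₁ u v)
      = ∑ u, w u * (∑ v, Real.negMulLog (m₀ u v + m₁ u v) - outEntropy (∑ v, m₀ u v) (∑ v, m₁ u v))
        - ∑ v, outEntropy (∑ u, w u * m₁ u v) (∑ u, w u * m₀ u v) := by
  unfold objective
  rw [← Finset.sum_sub_distrib]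
  congr 1
  exact Finset.sum_congr rfl fun u _ => sum_negMulLog_sub_outEntropy_mul (w u)

/-- Row terms are linear in the weights, and column terms are minus a concave function of linear
expressions. -/
lemma convexOn_objective_mul {m₀ m₁ : α → β → ℝ} (h₀ : ∀ u v, 0 ≤ m₀ u v) (h₁ : ∀ u v, 0 ≤ m₁ u v) :
    ConvexOn ℝ (Set.Ici (0 : α → ℝ))
      fun w => objective (fun u v => w u * m₀ u v) (fun u v => w u * m₁ u v) := by
  refine ⟨convex_Ici _, fun w hw z hz a b ha hb hab => ?_⟩
  simp only [objective_mul, smul_eq_mul, Pi.add_apply, Pi.smul_apply]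
  have hcol : ∀ v, a * outEntropy (∑ u, w u * m₁ u v) (∑ u, w u * m₀ u v)
      + b * outEntropy (∑ u, z u * m₁ u v) (∑ u, z u * m₀ u v)
      ≤ outEntropy (∑ u, (a * w u + b * z u) * m₁ u v) (∑ u, (a * w u + b * z u) * m₀ u v) := by
    intro v
    simp only [add_mul, mul_assoc, Finset.sum_add_distrib, ← Finset.mul_sum]
    exact outEntropy_le_outEntropy_add
      (Finset.sum_nonneg fun u _ => mul_nonneg (hw u) (h₁ u v))
      (Finset.sum_nonneg fun u _ => mul_nonneg (hw u) (h₀ u v))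
      (Finset.sum_nonneg fun u _ => mul_nonneg (hz u) (h₁ u v))
      (Finset.sum_nonneg fun u _ => mul_nonneg (hz u) (h₀ u v)) ha hb hab
  have := Finset.sum_le_sum fun v (_ : v ∈ Finset.univ) => hcol v
  simp only [Finset.sum_add_distrib, ← Finset.mul_sum] at this
  simp only [add_mul, Finset.sum_add_distrib, mul_assoc, ← Finset.mul_sum] at this ⊢
  linarith

lemma exists_step_to_boundary {w δ : α → ℝ} (hw : 0 ≤ w) (hδ : ∀ u, w u = 0 → δ u = 0)
    (hneg : ∃ u, δ u < 0) :
    ∃ s : ℝ, 0 < s ∧ 0 ≤ w + s • δ ∧ ∃ u, w u ≠ 0 ∧ (w + s • δ) u = 0 := by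
  classical
  obtain ⟨u, hu⟩ := hneg
  obtain ⟨x, hx, hmin⟩ := Finset.exists_min_image (Finset.univ.filter fun u => δ u < 0)
    (fun u => w u / -δ u) ⟨u, by simpa using hu⟩
  simp only [Finset.mem_filter, Finset.mem_univ, true_and] at hx hmin
  have hwx : w x ≠ 0 := fun h => hx.ne (hδ x h)
  have hpos : 0 < w x := lt_of_le_of_ne (hw x) hwx.symm
  have hs : 0 < w x / -δ x := div_pos hpos (by linarith)
  -- The step length at which the first coordinate vanishes.
  refine ⟨w x / -δ x, hs, fun y => ?_, x, hwx, ?_⟩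
  · simp only [Pi.zero_apply, Pi.add_apply, Pi.smul_apply, smul_eq_mul]
    rcases le_or_gt 0 (δ y) with h | h
    · have := hw y
      simp only [Pi.zero_apply] at this
      positivity
    · have := hmin y h
      rw [le_div_iff₀ (by linarith)] at this
      linarith
  · simp only [Pi.add_apply, Pi.smul_apply, smul_eq_mul]
    field_simp [hx.ne]
    ring

open Classical in
lemma card_support_lt {w z : α → ℝ} (h : ∀ u, w u = 0 → z u = 0) (h' : ∃ u, w u ≠ 0 ∧ z u = 0) :
    (Finset.univ.filter fun u => z u ≠ 0).card < (Finset.univ.filter fun u => w u ≠ 0).card := by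
  obtain ⟨u, h1, h2⟩ := h'
  refine Finset.card_lt_card ⟨fun x hx => ?_, fun hsub => ?_⟩
  · simp only [Finset.mem_filter, Finset.mem_univ, true_and] at hx ⊢
    exact fun h3 => hx (h x h3)
  · have := @hsub u (by simpa using h1)
    simp [h2] at this

open Classical in
lemma exists_relation {w : α → ℝ} (r₀ r₁ : α → ℝ)
    (hcard : 2 < (Finset.univ.filter fun u => w u ≠ 0).card) :
    ∃ δ : α → ℝ, δ ≠ 0 ∧ (∀ u, w u = 0 → δ u = 0) ∧ ∑ u, δ u * r₀ u = 0 ∧ ∑ u, δ u * r₁ u = 0 := by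
  let S := {u // w u ≠ 0}
  let f : (S → ℝ) →ₗ[ℝ] ℝ × ℝ :=
    { toFun := fun x => (∑ i, x i * r₀ i, ∑ i, x i * r₁ i)
      map_add' := fun x y => by simp [add_mul, Finset.sum_add_distrib]
      map_smul' := fun a x => by simp [mul_assoc, Finset.mul_sum] }
  have hlt : Module.finrank ℝ (ℝ × ℝ) < Module.finrank ℝ (S → ℝ) := by
    rw [Module.finrank_prod, Module.finrank_self, Module.finrank_fintype_fun_eq_card,
      Fintype.card_subtype]
    exact hcard
  obtain ⟨x, hx, hx0⟩ := (Submodule.ne_bot_iff _).1 (LinearMap.ker_ne_bot_of_finrank_lt hlt (f := f))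
  have hsum : ∀ r : α → ℝ, ∑ u, (if h : w u ≠ 0 then x ⟨u, h⟩ else 0) * r u = ∑ i, x i * r i := by
    intro r
    refine (Fintype.sum_of_injective ((↑) : S → α) Subtype.val_injective _ _ (fun u hu => ?_)
      fun i => ?_).symm
    · have : w u = 0 := by
        by_contra h
        exact hu ⟨⟨u, h⟩, rfl⟩
      simp [this]
    · simp [i.2]
  refine ⟨fun u => if h : w u ≠ 0 then x ⟨u, h⟩ else 0, fun h0 => hx0 ?_, fun u hu => by simp [hu],
    ?_, ?_⟩
  · ext i
    have := congrFun h0 i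
    simpa [i.2] using this
  · rw [hsum]
    exact congrArg Prod.fst (LinearMap.mem_ker.1 hx)
  · rw [hsum]
    exact congrArg Prod.snd (LinearMap.mem_ker.1 hx)

-- More than two row-mass vectors in the plane satisfy a linear relation `δ`. Moving along `δ` and
-- `-δ` until a weight vanishes keeps both masses of `X`; since `w` lies between the two end points,
-- convexity makes one of them at least as good.
open Classical in
lemma exists_smaller_support {m₀ m₁ : α → β → ℝ} (h₀ : ∀ u v, 0 ≤ m₀ u v) (h₁ : ∀ u v, 0 ≤ m₁ u v)
    {w : α → ℝ} (hw : 0 ≤ w) (hcard : 2 < (Finset.univ.filter fun u => w u ≠ 0).card) :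
    ∃ z : α → ℝ, 0 ≤ z ∧
      (Finset.univ.filter fun u => z u ≠ 0).card < (Finset.univ.filter fun u => w u ≠ 0).card ∧
      ∑ u, z u * ∑ v, m₀ u v = ∑ u, w u * ∑ v, m₀ u v ∧
      ∑ u, z u * ∑ v, m₁ u v = ∑ u, w u * ∑ v, m₁ u v ∧
      objective (fun u v => w u * m₀ u v) (fun u v => w u * m₁ u v)
        ≤ objective (fun u v => z u * m₀ u v) (fun u v => z u * m₁ u v) := by
  by_cases hzero : ∃ u, w u ≠ 0 ∧ ∀ v, m₀ u v = 0 ∧ m₁ u v = 0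
  · obtain ⟨x, hx, hm⟩ := hzero
    have e₀ : ∀ u v, Function.update w x 0 u * m₀ u v = w u * m₀ u v := fun u v => by
      rcases eq_or_ne u x with rfl | h <;> simp [*]
    have e₁ : ∀ u v, Function.update w x 0 u * m₁ u v = w u * m₁ u v := fun u v => by
      rcases eq_or_ne u x with rfl | h <;> simp [*]
    refine ⟨Function.update w x 0, fun u => ?_, card_support_lt (fun u hu => ?_) ⟨x, hx, by simp⟩,
      ?_, ?_, ?_⟩
    · rcases eq_or_ne u x with rfl | h
      · simp
      · simpa [h] using hw u
    · rcases eq_or_ne u x with rfl | h <;> simp [*]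
    · simp only [Finset.mul_sum, e₀]
    · simp only [Finset.mul_sum, e₁]
    · simp only [e₀, e₁, le_refl]
  · push Not at hzero
    obtain ⟨δ, hne, hsupp, hs₀, hs₁⟩ :=
      exists_relation (fun u => ∑ v, m₀ u v) (fun u => ∑ v, m₁ u v) hcard
    have hpos : ∀ u, w u ≠ 0 → 0 < ∑ v, m₀ u v + ∑ v, m₁ u v := by
      intro u hu
      obtain ⟨v, hv⟩ := hzero u hu
      rw [← Finset.sum_add_distrib]
      refine Finset.sum_pos' (fun v _ => add_nonneg (h₀ u v) (h₁ u v)) ⟨v, Finset.mem_univ v, ?_⟩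
      rcases (h₀ u v).eq_or_lt with h | h
      · have := lt_of_le_of_ne (h₁ u v) (hv h.symm).symm
        linarith
      · linarith [h₁ u v]
    have hsum : ∑ u, δ u * (∑ v, m₀ u v + ∑ v, m₁ u v) = 0 := by
      simp only [mul_add, Finset.sum_add_distrib]
      linarith
    obtain ⟨x, hx⟩ : ∃ x, δ x ≠ 0 := by
      by_contra! h
      exact hne (funext h)
    -- A nonzero relation is orthogonal to the positive row totals, so it has a negative entry.
    have hboth : ∀ ε : α → ℝ, (∀ u, w u = 0 → ε u = 0) → ε x ≠ 0 →
        ∑ u, ε u * (∑ v, m₀ u v + ∑ v, m₁ u v) = 0 → ∃ u, ε u < 0 := by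
      intro ε hε hεx h
      by_contra! hge
      have hterm : ∀ u ∈ Finset.univ, 0 ≤ ε u * (∑ v, m₀ u v + ∑ v, m₁ u v) := fun u _ =>
        mul_nonneg (hge u) (add_nonneg (Finset.sum_nonneg fun v _ => h₀ u v)
          (Finset.sum_nonneg fun v _ => h₁ u v))
      have := (Finset.sum_eq_zero_iff_of_nonneg hterm).1 h x (Finset.mem_univ x)
      rcases mul_eq_zero.1 this with h2 | h2
      · exact hεx h2
      · exact (hpos x fun h3 => hεx (hε x h3)).ne' h2
    obtain ⟨s, hs, hws, u, hu, hu0⟩ := exists_step_to_boundary hw hsupp (hboth δ hsupp hx hsum)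
    obtain ⟨t, ht, hwt, u', hu', hu0'⟩ := exists_step_to_boundary (δ := -δ) hw
      (fun u hu => by simp [hsupp u hu])
      (hboth (-δ) (fun u hu => by simp [hsupp u hu]) (by simpa using hx)
        (by simpa [Finset.sum_neg_distrib] using hsum))
    have hconv := (convexOn_objective_mul h₀ h₁).le_max_of_mem_segment (x := w + s • δ)
      (y := w + t • -δ) (z := w) hws hwt ⟨t / (s + t), s / (s + t), by positivity, by positivity,
        by field_simp; ring, by
          ext y
          simp only [Pi.add_apply, Pi.smul_apply, smul_eq_mul, Pi.neg_apply]
          field_simp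
          ring⟩
    have hline : ∀ (c : ℝ) (r : α → ℝ), ∑ u, δ u * r u = 0 →
        ∑ u, (w u + c * δ u) * r u = ∑ u, w u * r u := by
      intro c r hr
      simp only [add_mul, mul_assoc, Finset.sum_add_distrib, ← Finset.mul_sum, hr]
      ring
    rcases le_max_iff.1 hconv with h | h
    · exact ⟨_, hws, card_support_lt (fun u hu => by simp [hu, hsupp u hu]) ⟨u, hu, hu0⟩,
        by simpa using hline s _ hs₀, by simpa using hline s _ hs₁, h⟩
    · exact ⟨_, hwt, card_support_lt (fun u hu => by simp [hu, hsupp u hu]) ⟨u', hu', hu0'⟩,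
        by simpa using hline (-t) _ hs₀, by simpa using hline (-t) _ hs₁, h⟩

open Classical in
/-- Reweighting the values of `U` reduces their number to two. -/
lemma exists_weights {m₀ m₁ : α → β → ℝ} (h₀ : ∀ u v, 0 ≤ m₀ u v) (h₁ : ∀ u v, 0 ≤ m₁ u v) :
    ∃ z : α → ℝ, 0 ≤ z ∧ (Finset.univ.filter fun u => z u ≠ 0).card ≤ 2 ∧
      ∑ u, ∑ v, z u * m₀ u v = ∑ u, ∑ v, m₀ u v ∧ ∑ u, ∑ v, z u * m₁ u v = ∑ u, ∑ v, m₁ u v ∧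
      objective m₀ m₁ ≤ objective (fun u v => z u * m₀ u v) (fun u v => z u * m₁ u v) := by
  have main : ∀ (n : ℕ) (w : α → ℝ), 0 ≤ w → (Finset.univ.filter fun u => w u ≠ 0).card = n →
      ∃ z : α → ℝ, 0 ≤ z ∧ (Finset.univ.filter fun u => z u ≠ 0).card ≤ 2 ∧
      ∑ u, z u * ∑ v, m₀ u v = ∑ u, w u * ∑ v, m₀ u v ∧
      ∑ u, z u * ∑ v, m₁ u v = ∑ u, w u * ∑ v, m₁ u v ∧
      objective (fun u v => w u * m₀ u v) (fun u v => w u * m₁ u v)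
        ≤ objective (fun u v => z u * m₀ u v) (fun u v => z u * m₁ u v) := by
    intro n
    induction n using Nat.strong_induction_on with
    | _ n ih =>
      intro w hw hn
      rcases le_or_gt n 2 with hle | hlt
      · exact ⟨w, hw, hn ▸ hle, rfl, rfl, le_rfl⟩
      · obtain ⟨y, hy, hcard, e₀, e₁, hle⟩ := exists_smaller_support h₀ h₁ hw (hn ▸ hlt)
        obtain ⟨z, hz, hc, f₀, f₁, hle'⟩ := ih _ (hn ▸ hcard) y hy rfl
        exact ⟨z, hz, hc, f₀.trans e₀, f₁.trans e₁, hle.trans hle'⟩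
  obtain ⟨z, hz, hc, e₀, e₁, hle⟩ := main _ 1 (by simp) rfl
  simp only [Pi.one_apply, one_mul] at e₀ e₁ hle
  exact ⟨z, hz, hc, by simpa only [Finset.mul_sum] using e₀,
    by simpa only [Finset.mul_sum] using e₁, hle⟩

open Classical in
lemma exists_pair_of_card_support_le {z : α → ℝ} [Nontrivial α]
    (h : (Finset.univ.filter fun u => z u ≠ 0).card ≤ 2) :
    ∃ x y, x ≠ y ∧ ∀ u, u ≠ x ∧ u ≠ y → z u = 0 := by
  obtain ⟨t, hsub, ht⟩ := Finset.exists_superset_card_eq h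
    (Nat.succ_le_of_lt (Fintype.one_lt_card (α := α)))
  obtain ⟨x, y, hxy, rfl⟩ := Finset.card_eq_two.1 ht
  refine ⟨x, y, hxy, fun u hu => ?_⟩
  by_contra h0
  have := @hsub u (by simpa using h0)
  simp [hu.1, hu.2] at this

lemma objective_le_target_of_pairs {m₀ m₁ : α → β → ℝ} (h₀ : ∀ u v, 0 ≤ m₀ u v)
    (h₁ : ∀ u v, 0 ≤ m₁ u v) (hdet : ∀ u v, m₀ u v = 0 ∨ m₁ u v = 0) {x y : α} (hxy : x ≠ y)
    {x' y' : β} (hxy' : x' ≠ y') (hrow : ∀ u, u ≠ x ∧ u ≠ y → ∀ v, m₀ u v = 0 ∧ m₁ u v = 0)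
    (hcol : ∀ v, v ≠ x' ∧ v ≠ y' → ∀ u, m₀ u v = 0 ∧ m₁ u v = 0) :
    objective m₀ m₁ ≤ target (∑ u, ∑ v, m₀ u v) (∑ u, ∑ v, m₁ u v) := by
  have sr : ∀ f : α → ℝ, (∀ u, u ≠ x ∧ u ≠ y → f u = 0) → ∑ u, f u = f x + f y :=
    fun f hf => Fintype.sum_eq_add x y hxy hf
  have sc : ∀ f : β → ℝ, (∀ v, v ≠ x' ∧ v ≠ y' → f v = 0) → ∑ v, f v = f x' + f y' :=
    fun f hf => Fintype.sum_eq_add x' y' hxy' hf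
  have c₀ : ∀ u, ∑ v, m₀ u v = m₀ u x' + m₀ u y' := fun u => sc _ fun v hv => (hcol v hv u).1
  have c₁ : ∀ u, ∑ v, m₁ u v = m₁ u x' + m₁ u y' := fun u => sc _ fun v hv => (hcol v hv u).2
  have r₀ : ∀ v, ∑ u, m₀ u v = m₀ x v + m₀ y v := fun v => sr _ fun u hu => (hrow u hu v).1
  have r₁ : ∀ v, ∑ u, m₁ u v = m₁ x v + m₁ y v := fun v => sr _ fun u hu => (hrow u hu v).2
  have h := binBound_of_deterministic (h₀ x x') (h₁ x x') (h₀ x y') (h₁ x y') (h₀ y x') (h₁ y x')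
    (h₀ y y') (h₁ y y') (hdet _ _) (hdet _ _) (hdet _ _) (hdet _ _)
  unfold objective
  simp only [c₀, c₁, r₀, r₁]
  rw [sr (fun u => m₀ u x' + m₀ u y') fun u hu => by simp [hrow u hu],
    sr (fun u => m₁ u x' + m₁ u y') fun u hu => by simp [hrow u hu],
    sr (fun u => outEntropy _ _) fun u hu => by simp [hrow u hu, outEntropy],
    sc (fun v => outEntropy _ _) fun v hv => by simp [hcol v hv, outEntropy],
    sr (fun u => ∑ v, _) fun u hu => by simp [hrow u hu],
    sc _ fun v hv => by simp [hcol v hv], sc _ fun v hv => by simp [hcol v hv]]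
  unfold BinBound binObjective at h
  simp only [← add_assoc] at h ⊢
  linarith

lemma objective_le_target_of_deterministic [Nontrivial α] [Nontrivial β] {m₀ m₁ : α → β → ℝ}
    (h₀ : ∀ u v, 0 ≤ m₀ u v) (h₁ : ∀ u v, 0 ≤ m₁ u v) (hdet : ∀ u v, m₀ u v = 0 ∨ m₁ u v = 0) :
    objective m₀ m₁ ≤ target (∑ u, ∑ v, m₀ u v) (∑ u, ∑ v, m₁ u v) := by
  obtain ⟨w, hw, hwc, e₀, e₁, hle⟩ := exists_weights h₀ h₁
  obtain ⟨x, y, hxy, hx⟩ := exists_pair_of_card_support_le hwc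
  -- The second reduction acts on the transposed masses; reweighting keeps empty cells empty, so
  -- determinism survives.
  obtain ⟨z, hz, hzc, f₀, f₁, hle'⟩ := exists_weights (m₀ := fun v u => w u * m₁ u v)
    (m₁ := fun v u => w u * m₀ u v) (fun v u => mul_nonneg (hw u) (h₁ u v))
    (fun v u => mul_nonneg (hw u) (h₀ u v))
  obtain ⟨x', y', hxy', hx'⟩ := exists_pair_of_card_support_le hzc
  have h := objective_le_target_of_pairs (m₀ := fun u v => z v * (w u * m₀ u v))
    (m₁ := fun u v => z v * (w u * m₁ u v))
    (fun u v => mul_nonneg (hz v) (mul_nonneg (hw u) (h₀ u v)))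
    (fun u v => mul_nonneg (hz v) (mul_nonneg (hw u) (h₁ u v)))
    (fun u v => (hdet u v).imp (fun h => by simp [h]) (fun h => by simp [h])) hxy hxy'
    (fun u hu v => by simp [hx u hu]) (fun v hv u => by simp [hx' v hv])
  rw [objective_transpose, objective_transpose (fun u v => z v * (w u * m₀ u v))] at hle'
  rw [Finset.sum_comm, Finset.sum_comm (f := fun v u => w u * m₁ u v)] at f₀
  rw [Finset.sum_comm, Finset.sum_comm (f := fun v u => w u * m₀ u v)] at f₁
  rw [f₀, f₁, e₀, e₁] at h
  exact hle.trans (hle'.trans h)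

end General

/-! ### Reduction to `X` a function of `(U, V)`. -/

section Deterministic

variable {α β : Type*} [Fintype α] [Fintype β]

/-- Splitting a row at random does not decrease its contribution to the objective. -/
lemma row_le_sum_split {ι : Type*} [Fintype ι] {m : β → ℝ} {l s t : ι → ℝ}
    (hl : ∑ i, l i = 1) (hs : ∀ i, 0 ≤ s i) (ht : ∀ i, 0 ≤ t i)
    (hst : ∀ i, s i + t i = l i * ∑ v, m v) :
    ∑ v, Real.negMulLog (m v) - outEntropy (∑ i, s i) (∑ i, t i)
      ≤ ∑ i, (∑ v, Real.negMulLog (m v * l i) - outEntropy (s i) (t i)) := by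
  have h := sum_splitEntropy_le Finset.univ (s := fun i => s i / 2) (t := fun i => t i + s i / 2)
    -- This is `H(Y₁ | U, S) ≤ H(Y₁ | U)`; the entropy of `l` enters both `H(U,S,V)` and `H(U,S,Y₁)`
    -- and cancels.
    (fun i => by have := hs i; positivity) (fun i => by have := hs i; have := ht i; positivity)
  rw [Finset.sum_add_distrib, ← Finset.sum_div] at h
  have e : ∑ i, s i + ∑ i, t i = ∑ v, m v := by
    rw [← Finset.sum_add_distrib]
    simp only [hst, ← Finset.sum_mul, hl, one_mul]
  simp only [outEntropy_eq, hst, e, Real.negMulLog_mul, Finset.sum_sub_distrib,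
    Finset.sum_add_distrib, ← Finset.mul_sum, ← Finset.sum_mul, hl]
  linarith

lemma sum_prod_eq_one [DecidableEq β] {q : β → Fin 2 → ℝ} (hq : ∀ v, ∑ x, q v x = 1) :
    ∑ S : β → Fin 2, ∏ v, q v (S v) = 1 := by
  rw [← Fintype.prod_sum]
  simp [hq]

lemma sum_prod_ite [DecidableEq β] {q : β → Fin 2 → ℝ} (hq : ∀ v, ∑ x, q v x = 1) (v : β)
    (x : Fin 2) :
    ∑ S : β → Fin 2, (if S v = x then ∏ v, q v (S v) else 0) = q v x := by
  -- The indicator is absorbed into the factor at `v`, so the sum over `S` factorises.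
  have h : ∀ S : β → Fin 2, (if S v = x then ∏ v, q v (S v) else 0)
      = ∏ v', (if v' = v then (if S v' = x then q v' (S v') else 0) else q v' (S v')) := by
    intro S
    split_ifs with h
    · refine Finset.prod_congr rfl fun v' _ => ?_
      split_ifs with h1 h2 <;> simp_all
    · exact (Finset.prod_eq_zero (Finset.mem_univ v) (by simp [h])).symm
  simp only [h]
  rw [← Fintype.prod_sum
    (fun v' b => if v' = v then (if b = x then q v' b else 0) else q v' b)]
  rw [Finset.prod_eq_single v]
  · simp
  · intro v' _ hv'
    simp [hv', hq]
  · simp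

/-- Adjoining independent randomness to `U` makes `X` a function of `(U, V)`. -/
lemma exists_deterministic [DecidableEq β] {m₀ m₁ : α → β → ℝ} (h₀ : ∀ u v, 0 ≤ m₀ u v)
    (h₁ : ∀ u v, 0 ≤ m₁ u v) :
    ∃ n₀ n₁ : α × (β → Fin 2) → β → ℝ, (∀ u v, 0 ≤ n₀ u v) ∧ (∀ u v, 0 ≤ n₁ u v) ∧
      (∀ u v, n₀ u v = 0 ∨ n₁ u v = 0) ∧ ∑ u, ∑ v, n₀ u v = ∑ u, ∑ v, m₀ u v ∧
      ∑ u, ∑ v, n₁ u v = ∑ u, ∑ v, m₁ u v ∧ objective m₀ m₁ ≤ objective n₀ n₁ := by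
  obtain ⟨q, hq, hq1, hq₀, hq₁⟩ : ∃ q : α → β → Fin 2 → ℝ, (∀ u v x, 0 ≤ q u v x) ∧
      (∀ u v, ∑ x, q u v x = 1) ∧ (∀ u v, (m₀ u v + m₁ u v) * q u v 0 = m₀ u v) ∧
      (∀ u v, (m₀ u v + m₁ u v) * q u v 1 = m₁ u v) := by
    have : ∀ u v, ∃ r : Fin 2 → ℝ, (∀ x, 0 ≤ r x) ∧ ∑ x, r x = 1 ∧
        (m₀ u v + m₁ u v) * r 0 = m₀ u v ∧ (m₀ u v + m₁ u v) * r 1 = m₁ u v := by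
      intro u v
      have g₀ := h₀ u v
      have g₁ := h₁ u v
      rcases (add_nonneg g₀ g₁).eq_or_lt with h | h
      · refine ⟨![1, 0], by simp [Fin.forall_fin_two], by simp, ?_, ?_⟩
        · simp; linarith
        · simp; linarith
      · refine ⟨![m₀ u v / (m₀ u v + m₁ u v), m₁ u v / (m₀ u v + m₁ u v)], ?_, ?_, ?_, ?_⟩
        · simp only [Fin.forall_fin_two, Matrix.cons_val_zero, Matrix.cons_val_one]
          exact ⟨by positivity, by positivity⟩
        · simp only [Fin.sum_univ_two, Matrix.cons_val_zero, Matrix.cons_val_one]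
          field_simp
        · simp only [Matrix.cons_val_zero]
          field_simp
        · simp only [Matrix.cons_val_one, Matrix.cons_val_zero]
          field_simp
    choose q hq using this
    exact ⟨q, fun u v => (hq u v).1, fun u v => (hq u v).2.1, fun u v => (hq u v).2.2.1,
      fun u v => (hq u v).2.2.2⟩
  -- Given `U = u`, the values `S v` are independent with law `P(X = · | u, v)`, and `S` is
  -- independent of `V`. Setting `X = S(V)` keeps the law of `(U,V,X)`.
  set l : α → (β → Fin 2) → ℝ := fun u S => ∏ v, q u v (S v) with hl
  have hl0 : ∀ u S, 0 ≤ l u S := fun u S => Finset.prod_nonneg fun v _ => hq u v _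
  have hm : ∀ u v, 0 ≤ m₀ u v + m₁ u v := fun u v => add_nonneg (h₀ u v) (h₁ u v)
  set n : Fin 2 → α × (β → Fin 2) → β → ℝ := fun x u v =>
    (m₀ u.1 v + m₁ u.1 v) * (if u.2 v = x then l u.1 u.2 else 0) with hn
  have hn0 : ∀ x u v, 0 ≤ n x u v := by
    intro x u v
    have := hl0 u.1 u.2
    have := hm u.1 v
    simp only [hn]
    split_ifs <;> positivity
  have hsplit : ∀ x u v, ∑ S, n x (u, S) v = (m₀ u v + m₁ u v) * q u v x := by
    intro x u v
    simp only [hn, ← Finset.mul_sum]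
    rw [sum_prod_ite (hq1 u)]
  have hadd : ∀ u S v, n 0 (u, S) v + n 1 (u, S) v = (m₀ u v + m₁ u v) * l u S := by
    intro u S v
    simp only [hn]
    obtain h | h : S v = 0 ∨ S v = 1 := by omega
    all_goals simp [h]
  have hcol₀ : ∀ v, ∑ u, n 0 u v = ∑ u, m₀ u v := fun v => by
    rw [Fintype.sum_prod_type]
    simp only [hsplit, hq₀]
  have hcol₁ : ∀ v, ∑ u, n 1 u v = ∑ u, m₁ u v := fun v => by
    rw [Fintype.sum_prod_type]
    simp only [hsplit, hq₁]
  refine ⟨n 0, n 1, hn0 0, hn0 1, ?_, ?_, ?_, ?_⟩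
  · rintro ⟨u, S⟩ v
    by_cases h : S v = 0
    · exact Or.inr (by simp [hn, h])
    · exact Or.inl (by simp [hn, h])
  · rw [Finset.sum_comm, Finset.sum_comm (f := m₀)]
    exact Finset.sum_congr rfl fun v _ => hcol₀ v
  · rw [Finset.sum_comm, Finset.sum_comm (f := m₁)]
    exact Finset.sum_congr rfl fun v _ => hcol₁ v
  · unfold objective
    simp only [hcol₀, hcol₁]
    rw [← Finset.sum_sub_distrib, ← Finset.sum_sub_distrib, Fintype.sum_prod_type]
    refine sub_le_sub_right (Finset.sum_le_sum fun u _ => ?_) _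
    have h := row_le_sum_split (m := fun v => m₀ u v + m₁ u v) (l := l u)
      (s := fun S => ∑ v, n 0 (u, S) v) (t := fun S => ∑ v, n 1 (u, S) v)
      (sum_prod_eq_one (hq1 u)) (fun S => Finset.sum_nonneg fun v _ => hn0 _ _ _)
      (fun S => Finset.sum_nonneg fun v _ => hn0 _ _ _) (fun S => by
        rw [← Finset.sum_add_distrib, Finset.mul_sum]
        exact Finset.sum_congr rfl fun v _ => by rw [hadd, mul_comm])
    rw [Finset.sum_comm, Finset.sum_comm (f := fun S v => n 1 (u, S) v)] at h
    simpa only [hsplit, hq₀, hq₁, hadd] using h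

theorem objective_le_target [Nonempty α] [Nonempty β] {m₀ m₁ : α → β → ℝ}
    (h₀ : ∀ u v, 0 ≤ m₀ u v) (h₁ : ∀ u v, 0 ≤ m₁ u v) :
    objective m₀ m₁ ≤ target (∑ u, ∑ v, m₀ u v) (∑ u, ∑ v, m₁ u v) := by
  classical
  -- An extra value of `V` with zero mass makes both alphabets nontrivial, so that two distinct
  -- values can be chosen.
  obtain ⟨n₀, n₁, g₀, g₁, hdet, e₀, e₁, hle⟩ := exists_deterministic
    (m₀ := fun u (v : Option β) => v.elim 0 (m₀ u)) (m₁ := fun u (v : Option β) => v.elim 0 (m₁ u))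
    (fun u v => by cases v <;> simp [h₀]) (fun u v => by cases v <;> simp [h₁])
  have h := objective_le_target_of_deterministic g₀ g₁ hdet
  rw [e₀, e₁] at h
  rw [objective_option] at hle
  simpa [Fintype.sum_option] using hle.trans h

end Deterministic

/-! ### From random variables to masses. -/

namespace BSSC

variable {Ω α β γ : Type*} [MeasurableSpace Ω] {μ : Measure Ω}

lemma pmass_congr {A : Ω → α} {B : Ω → β} {a : α} {b : β} (h : ∀ ω, A ω = a ↔ B ω = b) :
    pmass μ A a = pmass μ B b := by
  unfold pmass
  congr 1
  ext ω
  exact h ω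

lemma pmass_nonneg (A : Ω → α) (a : α) : 0 ≤ pmass μ A a := measureReal_nonneg

lemma IsMarkovChain.symm {A : Ω → α} {B : Ω → β} {C : Ω → γ} (h : IsMarkovChain μ A B C) :
    IsMarkovChain μ C B A := by
  intro c b a
  have e1 : pmass μ (fun ω => (C ω, B ω, A ω)) (c, b, a)
      = pmass μ (fun ω => (A ω, B ω, C ω)) (a, b, c) := pmass_congr fun ω => by
    simp only [Prod.mk.injEq]; tauto
  have e2 : pmass μ (fun ω => (C ω, B ω)) (c, b) = pmass μ (fun ω => (B ω, C ω)) (b, c) :=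
    pmass_congr fun ω => by simp only [Prod.mk.injEq]; tauto
  have e3 : pmass μ (fun ω => (B ω, A ω)) (b, a) = pmass μ (fun ω => (A ω, B ω)) (a, b) :=
    pmass_congr fun ω => by simp only [Prod.mk.injEq]; tauto
  rw [e1, e2, e3, h a b c, mul_comm]

variable [IsProbabilityMeasure μ]

lemma pmass_mono {A : Ω → α} {B : Ω → β} {a : α} {b : β} (h : ∀ ω, A ω = a → B ω = b) :
    pmass μ A a ≤ pmass μ B b :=
  measureReal_mono fun ω hω => h ω hω

lemma sum_pmass_prod [Fintype β] [MeasurableSpace β] [MeasurableSingletonClass β] (A : Ω → α)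
    {B : Ω → β} (hB : Measurable B) (a : α) :
    ∑ b, pmass μ (fun ω => (A ω, B ω)) (a, b) = pmass μ A a := by
  have h := sum_measureReal_preimage_singleton (μ := μ.restrict {ω | A ω = a}) Finset.univ
    (f := B) (fun b _ => hB (measurableSet_singleton b))
  simp only [Finset.coe_univ, Set.preimage_univ, measureReal_restrict_apply MeasurableSet.univ,
    Set.univ_inter] at h
  rw [pmass, ← h]
  refine Finset.sum_congr rfl fun b _ => ?_
  rw [measureReal_restrict_apply (hB (measurableSet_singleton b)), pmass]
  congr 1
  ext ω
  simp [and_comm]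

lemma sum_pmass_prod' [Fintype α] [MeasurableSpace α] [MeasurableSingletonClass α]
    {A : Ω → α} (hA : Measurable A) (B : Ω → β) (b : β) :
    ∑ a, pmass μ (fun ω => (A ω, B ω)) (a, b) = pmass μ B b := by
  rw [← sum_pmass_prod B hA b]
  exact Finset.sum_congr rfl fun a _ => pmass_congr fun ω => by simp [and_comm]

lemma mutualInfo_mul_log [Fintype α] [MeasurableSpace α] [MeasurableSingletonClass α] [Fintype β]
    [MeasurableSpace β] [MeasurableSingletonClass β] {A : Ω → α} (hA : Measurable A) {B : Ω → β}
    (hB : Measurable B) :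
    mutualInfo μ A B * Real.log 2 = ∑ a, Real.negMulLog (pmass μ A a)
      + ∑ b, Real.negMulLog (pmass μ B b)
      - ∑ a, ∑ b, Real.negMulLog (pmass μ (fun ω => (A ω, B ω)) (a, b)) := by
  have hterm : ∀ a b, pmass μ (fun ω => (A ω, B ω)) (a, b) *
      Real.logb 2 (pmass μ (fun ω => (A ω, B ω)) (a, b) / (pmass μ A a * pmass μ B b)) * Real.log 2
      = pmass μ (fun ω => (A ω, B ω)) (a, b) * -Real.log (pmass μ A a)
        + pmass μ (fun ω => (A ω, B ω)) (a, b) * -Real.log (pmass μ B b)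
        - Real.negMulLog (pmass μ (fun ω => (A ω, B ω)) (a, b)) := by
    intro a b
    have hlog : Real.log 2 ≠ 0 := (Real.log_pos one_lt_two).ne'
    rcases (pmass_nonneg (μ := μ) (fun ω => (A ω, B ω)) (a, b)).eq_or_lt with h | h
    · simp [← h]
    · have ha : 0 < pmass μ A a := h.trans_le (pmass_mono fun ω hω => (Prod.mk.inj hω).1)
      have hb : 0 < pmass μ B b := h.trans_le (pmass_mono fun ω hω => (Prod.mk.inj hω).2)
      rw [mul_assoc, Real.logb, div_mul_cancel₀ _ hlog, Real.log_div h.ne' (by positivity),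
        Real.log_mul ha.ne' hb.ne', Real.negMulLog]
      ring
  have e1 : ∑ a, ∑ b, pmass μ (fun ω => (A ω, B ω)) (a, b) * -Real.log (pmass μ A a)
      = ∑ a, Real.negMulLog (pmass μ A a) := by
    refine Finset.sum_congr rfl fun a _ => ?_
    rw [← Finset.sum_mul, sum_pmass_prod A hB, Real.negMulLog]
    ring
  have e2 : ∑ a, ∑ b, pmass μ (fun ω => (A ω, B ω)) (a, b) * -Real.log (pmass μ B b)
      = ∑ b, Real.negMulLog (pmass μ B b) := by
    rw [Finset.sum_comm]
    refine Finset.sum_congr rfl fun b _ => ?_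
    rw [← Finset.sum_mul, sum_pmass_prod' hA B, Real.negMulLog]
    ring
  simp only [mutualInfo, Finset.sum_mul, hterm, Finset.sum_add_distrib, Finset.sum_sub_distrib, e1,
    e2]

lemma pmass_comp_prod [Fintype α] [MeasurableSpace α] [MeasurableSingletonClass α] {δ : Type*}
    [DecidableEq δ] {A : Ω → α} (hA : Measurable A) (f : α → δ) (B : Ω → β) (d : δ) (b : β) :
    pmass μ (fun ω => (f (A ω), B ω)) (d, b)
      = ∑ a, if f a = d then pmass μ (fun ω => (A ω, B ω)) (a, b) else 0 := by
  rw [← sum_pmass_prod' hA]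
  refine Finset.sum_congr rfl fun a _ => ?_
  split_ifs with h
  · refine pmass_congr fun ω => ?_
    simp only [Prod.mk.injEq]
    constructor
    · tauto
    · rintro ⟨rfl, hb⟩
      exact ⟨rfl, h, hb⟩
  · rw [pmass, show {ω | (A ω, f (A ω), B ω) = (a, d, b)} = ∅ from ?_, measureReal_empty]
    ext ω
    simp only [Prod.mk.injEq, Set.mem_ofPred_eq, Set.mem_empty_iff_false, iff_false]
    rintro ⟨rfl, h1, -⟩
    exact h h1

lemma IsMarkovChain.comp_left [Fintype α] [MeasurableSpace α] [MeasurableSingletonClass α]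
    {δ : Type*} {A : Ω → α} (hA : Measurable A) {B : Ω → β} {C : Ω → γ}
    (h : IsMarkovChain μ A B C) (f : α → δ) : IsMarkovChain μ (fun ω => f (A ω)) B C := by
  classical
  intro d b c
  rw [pmass_comp_prod hA f (fun ω => (B ω, C ω)), pmass_comp_prod hA f B, Finset.sum_mul,
    Finset.sum_mul]
  refine Finset.sum_congr rfl fun a _ => ?_
  split_ifs
  · exact h a b c
  · simp

lemma IsMarkovChain.pmass_output [Fintype β] [MeasurableSpace β] [MeasurableSingletonClass β]
    {A : Ω → α} {B : Ω → β} (hB : Measurable B) {C : Ω → γ} {W : β → γ → ℝ}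
    (h : IsMarkovChain μ A B C) (hW : IsOutput μ W B C) (a : α) (c : γ) :
    pmass μ (fun ω => (A ω, C ω)) (a, c) = ∑ b, pmass μ (fun ω => (A ω, B ω)) (a, b) * W b c := by
  rw [← sum_pmass_prod _ hB]
  refine Finset.sum_congr rfl fun b _ => ?_
  have e : pmass μ (fun ω => ((A ω, C ω), B ω)) ((a, c), b)
      = pmass μ (fun ω => (A ω, B ω, C ω)) (a, b, c) := pmass_congr fun ω => by
    simp only [Prod.mk.injEq]; tauto
  rw [e]
  have h1 := h a b c
  rw [hW b c] at h1
  -- Where `P(B = b) = 0` nothing can be cancelled, but both joint masses vanish.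
  rcases (pmass_nonneg (μ := μ) B b).eq_or_lt with h0 | h0
  · have h2 : pmass μ (fun ω => (A ω, B ω, C ω)) (a, b, c) ≤ 0 :=
      h0 ▸ pmass_mono fun ω hω => by simp only [Prod.mk.injEq] at hω; exact hω.2.1
    have h3 : pmass μ (fun ω => (A ω, B ω)) (a, b) ≤ 0 :=
      h0 ▸ pmass_mono fun ω hω => by simp only [Prod.mk.injEq] at hω; exact hω.2
    rw [le_antisymm h2 (pmass_nonneg _ _), le_antisymm h3 (pmass_nonneg _ _), zero_mul]
  · apply mul_right_cancel₀ h0.ne'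
    rw [h1]
    ring

lemma sum_negMulLog_output_fst {α : Type*} {X Y : Ω → Fin 2} {A : Ω → α} (hX : Measurable X)
    (h : IsMarkovChain μ A X Y) (hY : IsOutput μ chan1 X Y) (a : α) :
    ∑ y, Real.negMulLog (pmass μ (fun ω => (A ω, Y ω)) (a, y))
      = outEntropy (pmass μ (fun ω => (A ω, X ω)) (a, 0)) (pmass μ (fun ω => (A ω, X ω)) (a, 1)) := by
  simp only [h.pmass_output hX hY, Fin.sum_univ_two, chan1, outEntropy]
  simp [div_eq_mul_inv, add_comm]

lemma sum_negMulLog_output_snd {α : Type*} {X Y : Ω → Fin 2} {A : Ω → α} (hX : Measurable X)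
    (h : IsMarkovChain μ A X Y) (hY : IsOutput μ chan2 X Y) (a : α) :
    ∑ y, Real.negMulLog (pmass μ (fun ω => (A ω, Y ω)) (a, y))
      = outEntropy (pmass μ (fun ω => (A ω, X ω)) (a, 1)) (pmass μ (fun ω => (A ω, X ω)) (a, 0)) := by
  simp only [h.pmass_output hX hY, Fin.sum_univ_two, chan2, outEntropy]
  simp [div_eq_mul_inv, add_comm]

lemma sum_negMulLog_fst {X Y : Ω → Fin 2} (hX : Measurable X) (hY : IsOutput μ chan1 X Y) :
    ∑ y, Real.negMulLog (pmass μ Y y) = outEntropy (pmass μ X 0) (pmass μ X 1) := by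
  simp only [← sum_pmass_prod' hX Y, hY _ _, Fin.sum_univ_two, chan1, outEntropy]
  simp [div_eq_mul_inv, add_comm]

lemma sum_negMulLog_snd {X Y : Ω → Fin 2} (hX : Measurable X) (hY : IsOutput μ chan2 X Y) :
    ∑ y, Real.negMulLog (pmass μ Y y) = outEntropy (pmass μ X 1) (pmass μ X 0) := by
  simp only [← sum_pmass_prod' hX Y, hY _ _, Fin.sum_univ_two, chan2, outEntropy]
  simp [div_eq_mul_inv, add_comm]

lemma mutualInfo_fst {X Y : Ω → Fin 2} (hX : Measurable X) (hYm : Measurable Y)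
    (hY : IsOutput μ chan1 X Y) :
    mutualInfo μ X Y * Real.log 2
      = outEntropy (pmass μ X 0) (pmass μ X 1) - pmass μ X 0 * Real.log 2 := by
  rw [mutualInfo_mul_log hX hYm, sum_negMulLog_fst hX hY]
  have := negMulLog_half (pmass μ X 0)
  rw [div_eq_mul_inv] at this
  simp [hY _ _, Fin.sum_univ_two, chan1, this]
  ring

lemma mutualInfo_snd {X Y : Ω → Fin 2} (hX : Measurable X) (hYm : Measurable Y)
    (hY : IsOutput μ chan2 X Y) :
    mutualInfo μ X Y * Real.log 2
      = outEntropy (pmass μ X 1) (pmass μ X 0) - pmass μ X 1 * Real.log 2 := by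
  rw [mutualInfo_mul_log hX hYm, sum_negMulLog_snd hX hY]
  have := negMulLog_half (pmass μ X 1)
  rw [div_eq_mul_inv] at this
  simp [hY _ _, Fin.sum_univ_two, chan2, this]
  ring

end BSSC

theorem mainTheorem1 {Ω 𝒰 𝒱 : Type*} [MeasurableSpace Ω] (μ : Measure Ω) [IsProbabilityMeasure μ]
    [Fintype 𝒰] [MeasurableSpace 𝒰] [DiscreteMeasurableSpace 𝒰]
    [Fintype 𝒱] [MeasurableSpace 𝒱] [DiscreteMeasurableSpace 𝒱]
    (U : Ω → 𝒰) (V : Ω → 𝒱) (X Y₁ Y₂ : Ω → Fin 2)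
    (hU : Measurable U) (hV : Measurable V) (hX : Measurable X)
    (hY₁ : Measurable Y₁) (hY₂ : Measurable Y₂)
    (hchannel : BSSC.IsBSSCOutput μ X Y₁ Y₂)
    (hmarkov : BSSC.IsMarkovChain μ (fun ω => (U ω, V ω)) X (fun ω => (Y₁ ω, Y₂ ω))) :
    BSSC.mutualInfo μ U Y₁ + BSSC.mutualInfo μ V Y₂ - BSSC.mutualInfo μ U V ≤
      max (BSSC.mutualInfo μ X Y₁) (BSSC.mutualInfo μ X Y₂) := by
  obtain ⟨h₁, h₂⟩ := hchannel
  have hUV : Measurable fun ω => (U ω, V ω) := hU.prodMk hV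
  have hYY : Measurable fun ω => (Y₁ ω, Y₂ ω) := hY₁.prodMk hY₂
  -- Projecting each end of the chain gives `U - X - Y₁` and `V - X - Y₂`.
  have mU := ((hmarkov.comp_left hUV Prod.fst).symm.comp_left hYY Prod.fst).symm
  have mV := ((hmarkov.comp_left hUV Prod.snd).symm.comp_left hYY Prod.snd).symm
  obtain ⟨ω⟩ := nonempty_of_isProbabilityMeasure μ
  have : Nonempty 𝒰 := ⟨U ω⟩
  have : Nonempty 𝒱 := ⟨V ω⟩
  set m : Fin 2 → 𝒰 → 𝒱 → ℝ := fun x u v => BSSC.pmass μ (fun ω => ((U ω, V ω), X ω)) ((u, v), x)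
    with hm
  have hmain := objective_le_target (m₀ := m 0) (m₁ := m 1)
    (fun u v => BSSC.pmass_nonneg _ _) (fun u v => BSSC.pmass_nonneg _ _)
  have hrow : ∀ x u, ∑ v, m x u v = BSSC.pmass μ (fun ω => (U ω, X ω)) (u, x) := by
    intro x u
    rw [← BSSC.sum_pmass_prod _ hV]
    exact Finset.sum_congr rfl fun v _ => BSSC.pmass_congr fun ω => by
      simp only [Prod.mk.injEq]; tauto
  have hcol : ∀ x v, ∑ u, m x u v = BSSC.pmass μ (fun ω => (V ω, X ω)) (v, x) := by
    intro x v
    rw [← BSSC.sum_pmass_prod _ hU]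
    exact Finset.sum_congr rfl fun v _ => BSSC.pmass_congr fun ω => by
      simp only [Prod.mk.injEq]; tauto
  have htot : ∀ x, ∑ u, ∑ v, m x u v = BSSC.pmass μ X x := by
    intro x
    simp only [hrow]
    exact BSSC.sum_pmass_prod' hU X x
  have hcell : ∀ u v, m 0 u v + m 1 u v = BSSC.pmass μ (fun ω => (U ω, V ω)) (u, v) := by
    intro u v
    rw [← BSSC.sum_pmass_prod _ hX, Fin.sum_univ_two]
  rw [htot, htot, objective] at hmain
  simp only [hrow, hcol, hcell] at hmain
  have eU := BSSC.mutualInfo_mul_log (μ := μ) hU hY₁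
  have eV := BSSC.mutualInfo_mul_log (μ := μ) hV hY₂
  have eUV := BSSC.mutualInfo_mul_log (μ := μ) hU hV
  have e₁ := BSSC.mutualInfo_fst hX hY₁ h₁
  have e₂ := BSSC.mutualInfo_snd hX hY₂ h₂
  rw [BSSC.sum_negMulLog_fst hX h₁] at eU
  rw [BSSC.sum_negMulLog_snd hX h₂] at eV
  simp only [BSSC.sum_negMulLog_output_fst hX mU h₁] at eU
  simp only [BSSC.sum_negMulLog_output_snd hX mV h₂] at eV
  have hlog : 0 < Real.log 2 := Real.log_pos one_lt_two
  rcases le_max_iff.1 hmain with h | h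
  · refine le_max_of_le_left (le_of_mul_le_mul_right ?_ hlog)
    rw [sub_mul, add_mul]
    linarith
  · refine le_max_of_le_right (le_of_mul_le_mul_right ?_ hlog)
    rw [sub_mul, add_mul]
    linarith
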